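/- Let $K$ be a field and let $\mathbb{A}^{\to}_n$ be the linearly oriented quiver $1\to 2\to\cdots\to n$. All representations are over $K$, with a finite-dimensional vector space at each vertex. A representation is indecomposable if it is nonzero and is not the direct sum of two proper subrepresentations. A morphism $f\colon M\to N$ of representations is irreducible if it is neither a section nor a retraction and, for every factorization $f=f_1f_2$ with $f_2\colon M\to W$ and $f_1\colon W\to N$, either $f_1$ is a retraction or $f_2$ is a section. The Auslander--Reiten quiver $\Gamma=(\Gamma_0,\Gamma_1)$ of $\mathbb{A}^{\to}_n$ has as vertices the isomorphism classes of indecomposable representations, with one arrow $[M]\to[N]$ if there exists an irreducible morphism $M\to N$, and no arrow otherwise. For $1\le b\le d\le n$ let $\mathbb{I}[b,d]$ be the interval representation, with $\mathbb{I}[b,d]_i=K$ for $b\le i\le d$, $\mathbb{I}[b,d]_i=0$ otherwise, and the identity map for each arrow $K\to K$. Then the representations $\mathbb{I}[b,d]$ are indecomposable and $(b,d)\mapsto[\mathbb{I}[b,d]]$ is a bijection from the grid $\{(b,d)\in\mathbb{N}^2\mid 1\le b\le d\le n\}$ of persistence diagrams onto $\Gamma_0$. The arrows of $\Gamma$ are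 exactly $$[\mathbb{I}[b,d]]\to[\mathbb{I}[b-1,d]]\quad(1<b\le d\le n)\qquad\text{and}\qquad [\mathbb{I}[b,d]]\to[\mathbb{I}[b,d-1]]\quad(1\le b<d\le n).$$ -/

import Mathlib

open CategoryTheory

universe w v u

/-- A finite dimensional representation over `K` of a quiver `Q`: a finite dimensional vector
space at every vertex and a linear map for every arrow. -/
structure QuiverRep (K : Type u) [Field K] (Q : Type w) [Quiver.{v} Q] where
  /-- the vector space at a vertex -/
  space : Q → Type u
  [addCommGroup : ∀ a, AddCommGroup (space a)]
  [module : ∀ a, Module K (space a)]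
  [finiteDimensional : ∀ a, FiniteDimensional K (space a)]
  /-- the linear map of an arrow -/
  map : ∀ {a b : Q}, (a ⟶ b) → (space a →ₗ[K] space b)

namespace QuiverRep

attribute [instance] QuiverRep.addCommGroup QuiverRep.module QuiverRep.finiteDimensional

variable {K : Type u} [Field K] {Q : Type w} [Quiver.{v} Q]

/-- A morphism of representations: linear maps at the vertices that commute with the maps of
the arrows. -/
@[ext]
structure Hom (M N : QuiverRep K Q) where
  /-- the component at a vertex -/
  app : ∀ a : Q, M.space a →ₗ[K] N.space a
  comm : ∀ {a b : Q} (α : a ⟶ b), N.map α ∘ₗ app a = app b ∘ₗ M.map α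

/-- The category of finite dimensional representations of `Q` over `K`. -/
instance category : Category (QuiverRep K Q) where
  Hom M N := Hom M N
  id M := ⟨fun _ => LinearMap.id, fun _ => rfl⟩
  comp {L M N} f g := ⟨fun a => g.app a ∘ₗ f.app a, fun {a b} α => by
    rw [← LinearMap.comp_assoc, g.comm α, LinearMap.comp_assoc, f.comm α,
      LinearMap.comp_assoc]⟩

/-- A subrepresentation: subspaces at the vertices, closed under the maps of the arrows. -/
structure Subrep (M : QuiverRep K Q) where
  /-- the subspace at a vertex -/
  carrier : ∀ a : Q, Submodule K (M.space a)
  map_mem : ∀ {a b : Q} (α : a ⟶ b) (x : M.space a), x ∈ carrier a → M.map α x ∈ carrier b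

/-- A subrepresentation of `M` is proper if it is not all of `M`. -/
def Subrep.IsProper {M : QuiverRep K Q} (N : M.Subrep) : Prop :=
  ∃ a : Q, N.carrier a ≠ ⊤

/-- `M` is the (internal) direct sum of its subrepresentations `N` and `N'`. -/
def Subrep.IsDirectSum {M : QuiverRep K Q} (N N' : M.Subrep) : Prop :=
  ∀ a : Q, IsCompl (N.carrier a) (N'.carrier a)

/-- `M` is indecomposable: it is nonzero and not a direct sum of two proper
subrepresentations. -/
def IsIndecomposable (M : QuiverRep K Q) : Prop :=
  (∃ a : Q, Nontrivial (M.space a)) ∧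
    ¬ ∃ N N' : M.Subrep, N.IsProper ∧ N'.IsProper ∧ N.IsDirectSum N'

/-- A morphism `f` is irreducible if it is neither a section (`IsSplitMono`) nor a retraction
(`IsSplitEpi`), and in every factorization `f = f₁ ∘ f₂` the morphism `f₁` is a retraction or
`f₂` is a section. -/
def IsIrreducible {M N : QuiverRep K Q} (f : M ⟶ N) : Prop :=
  (¬ IsSplitMono f ∧ ¬ IsSplitEpi f) ∧
    ∀ (W : QuiverRep K Q) (f₂ : M ⟶ W) (f₁ : W ⟶ N), f = f₂ ≫ f₁ → IsSplitEpi f₁ ∨ IsSplitMono f₂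

/-- Isomorphism classes of representations. -/
abbrev IsoClass (K : Type u) [Field K] (Q : Type w) [Quiver.{v} Q] :=
  Quotient (isIsomorphicSetoid (QuiverRep K Q))

/-- The isomorphism class of a representation. -/
def isoClass (M : QuiverRep K Q) : IsoClass K Q := Quotient.mk _ M

end QuiverRep

/-- The vertices of the Auslander–Reiten quiver of the path algebra `KQ`: the isomorphism
classes of indecomposable representations. -/
def ARQuiver (K : Type u) [Field K] (Q : Type w) [Quiver.{v} Q] :=
  {c : QuiverRep.IsoClass K Q // ∃ M : QuiverRep K Q, M.isoClass = c ∧ M.IsIndecomposable}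

/-- The Auslander–Reiten quiver: there is one arrow `[M] ⟶ [N]` if an irreducible
morphism `M ⟶ N` exists, and none otherwise. -/
instance ARQuiver.quiver (K : Type u) [Field K] (Q : Type w) [Quiver.{v} Q] : Quiver (ARQuiver K Q) where
  Hom x y := PLift (∃ (M N : QuiverRep K Q) (f : M ⟶ N),
    M.isoClass = x.1 ∧ N.isoClass = y.1 ∧ QuiverRep.IsIrreducible f)

/-- The vertices `1, …, n` of the linearly oriented quiver of type `A_n`. -/
def LinearA (n : ℕ) : Type := {i : ℕ // 1 ≤ i ∧ i ≤ n}

/-- The linearly oriented quiver `1 ⟶ 2 ⟶ ⋯ ⟶ n`: one arrow `i ⟶ i + 1` for `1 ≤ i < n`. -/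
instance LinearA.quiver (n : ℕ) : Quiver (LinearA n) where
  Hom i j := PLift (i.1 + 1 = j.1)

/-- The space of the interval representation `I[b,d]` at the vertex `i`: it is `K`
for `b ≤ i ≤ d` and `0` otherwise. -/
noncomputable def intervalSpace (K : Type u) [Field K] (b d i : ℕ) : Submodule K K :=
  if b ≤ i ∧ i ≤ d then ⊤ else ⊥

/-- The map of `I[b,d]` from the vertex `i` to the vertex `j`: the identity of `K` if both spaces
are `K`, and zero otherwise. -/
noncomputable def intervalMap (K : Type u) [Field K] (b d i j : ℕ) :
    intervalSpace K b d i →ₗ[K] intervalSpace K b d j :=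
  if h : (b ≤ i ∧ i ≤ d) ∧ (b ≤ j ∧ j ≤ d) then
    Submodule.inclusion (le_top.trans_eq (if_pos h.2).symm)
  else 0

/-- The interval representation `I[b,d]` of the linearly oriented quiver of type `A_n`. -/
noncomputable def intervalRep (K : Type u) [Field K] (n b d : ℕ) :
    QuiverRep K (LinearA n) where
  space i := intervalSpace K b d i.1
  map {i j} _ := intervalMap K b d i.1 j.1

/-- The grid points `{(b,d) ∈ ℕ² | 1 ≤ b ≤ d ≤ n}` of persistence diagrams. -/
def PDGrid (n : ℕ) : Type := {p : ℕ × ℕ // 1 ≤ p.1 ∧ p.1 ≤ p.2 ∧ p.2 ≤ n}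

/-!
A morphism `I[b,d] ⟶ M` amounts to a vector of `M` at `b` that is dead after `d`, and a morphism
`M ⟶ I[b,d]` to a functional on `M` at `d` that kills whatever is born before `b`. Hence
`I[b,d] ⟶ M` is a section as soon as the image of the generator, transported to `d`, is not born
before `b`, and `M ⟶ I[b,d]` is a retraction as soon as it is nonzero on some vector at `b` that is
dead after `d`.

A nonzero vector at the first nonzero vertex of `M` therefore spans an interval summand of `M`, so
the indecomposables are the intervals. Now let a nonzero morphism from `I[b,d]` to `I[b-1,d]` or
`I[b,d-1]` factor through `W`, and let `x` be the image of the generator in `W`. If the first factor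
is not a section, then `x` transported to `d` is born before `b`. In the first case it comes from a
vector at `b - 1`, on which the second factor does not vanish; in the second case `x` agrees at `d`
with a vector born before `b`, and their difference is dead after `d - 1` and survives in
`I[b,d-1]`. Either way the second factor is a retraction. Any other nonzero morphism between
distinct intervals factors through an interval different from both.
-/

namespace QuiverRep

variable {K : Type u} [Field K] {Q : Type w} [Quiver.{v} Q] {L M N : QuiverRep K Q}

@[simp]
theorem id_app (a : Q) : Hom.app (𝟙 M) a = LinearMap.id := rfl

@[simp]
theorem comp_app (f : L ⟶ M) (g : M ⟶ N) (a : Q) :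
    Hom.app (f ≫ g) a = Hom.app g a ∘ₗ Hom.app f a := rfl

theorem hom_ext {f g : M ⟶ N} (h : ∀ a x, Hom.app f a x = Hom.app g a x) : f = g :=
  Hom.ext (funext fun a => LinearMap.ext (h a))

theorem map_app (f : M ⟶ N) {a b : Q} (α : a ⟶ b) (x : M.space a) :
    N.map α (Hom.app f a x) = Hom.app f b (M.map α x) :=
  LinearMap.congr_fun (Hom.comm f α) x

instance : Limits.HasZeroMorphisms (QuiverRep K Q) where
  zero M N := ⟨⟨fun _ => 0, fun _ => by rw [LinearMap.comp_zero, LinearMap.zero_comp]⟩⟩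
  comp_zero _ _ := rfl
  zero_comp _ _ _ f := hom_ext fun a _ => map_zero (Hom.app f a)

theorem zero_app_apply (a : Q) (x : M.space a) : Hom.app (0 : M ⟶ N) a x = 0 := rfl

theorem app_retraction_app (f : M ⟶ N) [IsSplitMono f] (a : Q) (x : M.space a) :
    Hom.app (retraction f) a (Hom.app f a x) = x := by
  rw [← LinearMap.comp_apply, ← comp_app, IsSplitMono.id, id_app, LinearMap.id_apply]

theorem app_injective (f : M ⟶ N) [IsSplitMono f] (a : Q) : Function.Injective (Hom.app f a) :=
  Function.LeftInverse.injective (app_retraction_app f a)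

section Paths

open Quiver

/-- The composite of the maps of `M` along a path. -/
def mapPath (M : QuiverRep K Q) {a : Q} : ∀ {b : Q}, Path a b → (M.space a →ₗ[K] M.space b)
  | _, .nil => LinearMap.id
  | _, .cons p α => M.map α ∘ₗ M.mapPath p

theorem mapPath_comp {a b c : Q} (p : Path a b) (q : Path b c) :
    M.mapPath (p.comp q) = M.mapPath q ∘ₗ M.mapPath p := by
  induction q with
  | nil => rfl
  | cons q α ih => rw [Path.comp_cons, mapPath, mapPath, ih, LinearMap.comp_assoc]

theorem app_mapPath (f : M ⟶ N) {a b : Q} (p : Path a b) (x : M.space a) :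
    Hom.app f b (M.mapPath p x) = N.mapPath p (Hom.app f a x) := by
  induction p with
  | nil => rfl
  | cons p α ih =>
    rw [mapPath, mapPath, LinearMap.comp_apply, LinearMap.comp_apply, ← ih, map_app]

theorem Subrep.mapPath_mem (S : M.Subrep) {a b : Q} (p : Path a b) {x : M.space a}
    (hx : x ∈ S.carrier a) : M.mapPath p x ∈ S.carrier b := by
  induction p with
  | nil => exact hx
  | cons p α ih => exact S.map_mem α _ ih

end Paths

section Indecomposable

/-- The image of a morphism. -/
def rangeSubrep (f : M ⟶ N) : N.Subrep where
  carrier a := LinearMap.range (Hom.app f a)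
  map_mem := by
    rintro a b α _ ⟨x, rfl⟩
    exact ⟨M.map α x, (map_app f α x).symm⟩

/-- The kernel of a morphism. -/
def kerSubrep (f : M ⟶ N) : M.Subrep where
  carrier a := LinearMap.ker (Hom.app f a)
  map_mem α x hx := by
    rw [LinearMap.mem_ker] at hx ⊢
    rw [← map_app, hx, map_zero]

/-- The equalizer of two morphisms. -/
def eqSubrep (f g : M ⟶ N) : M.Subrep where
  carrier a := LinearMap.eqLocus (Hom.app f a) (Hom.app g a)
  map_mem α x hx := by
    rw [LinearMap.mem_eqLocus] at hx ⊢
    rw [← map_app, ← map_app, hx]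

theorem isDirectSum_range_ker (f : M ⟶ N) [IsSplitMono f] :
    (rangeSubrep f).IsDirectSum (kerSubrep (retraction f)) := by
  intro a
  have hleft : Function.LeftInverse (Hom.app (retraction f) a) (Hom.app f a) :=
    app_retraction_app f a
  have hidem : IsIdempotentElem (Hom.app f a ∘ₗ Hom.app (retraction f) a) :=
    LinearMap.ext fun x => congrArg (Hom.app f a) (hleft _)
  have hcompl := LinearMap.IsIdempotentElem.isCompl hidem
  rwa [LinearMap.range_comp_of_range_eq_top _ (LinearMap.range_eq_top.2 hleft.surjective),
    LinearMap.ker_comp_of_ker_eq_bot _ (LinearMap.ker_eq_bot.2 hleft.injective)] at hcompl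

theorem IsIndecomposable.isIso_of_isSplitMono (hN : N.IsIndecomposable)
    (hM : ∃ a, Nontrivial (M.space a)) (f : M ⟶ N) [IsSplitMono f] : IsIso f := by
  have hker : (kerSubrep (retraction f)).IsProper := by
    obtain ⟨a, ha⟩ := hM
    obtain ⟨x, hx⟩ := exists_ne (0 : M.space a)
    refine ⟨a, fun htop => hx ?_⟩
    have hmem : Hom.app f a x ∈ (kerSubrep (retraction f)).carrier a := htop ▸ Submodule.mem_top
    rwa [kerSubrep, LinearMap.mem_ker, app_retraction_app] at hmem
  have hsurj : ∀ a, Function.Surjective (Hom.app f a) := by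
    by_contra! h
    obtain ⟨a, ha⟩ := h
    exact hN.2 ⟨_, _, ⟨a, fun htop => ha (LinearMap.range_eq_top.1 htop)⟩, hker,
      isDirectSum_range_ker f⟩
  refine ⟨retraction f, IsSplitMono.id f, hom_ext fun a y => ?_⟩
  obtain ⟨x, rfl⟩ := hsurj a y
  exact congrArg (Hom.app f a) (app_retraction_app f a x)

theorem IsIndecomposable.isIso_of_isSplitEpi (hM : M.IsIndecomposable)
    (hN : ∃ a, Nontrivial (N.space a)) (f : M ⟶ N) [IsSplitEpi f] : IsIso f :=
  have := hM.isIso_of_isSplitMono hN (section_ f)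
  IsIso.of_epi_section f

/-- The vector `x` generates `M`: no proper subrepresentation of `M` contains it. -/
def Generates {a : Q} (x : M.space a) : Prop :=
  ∀ S : M.Subrep, x ∈ S.carrier a → ¬ S.IsProper

theorem Generates.hom_ext {a : Q} {x : M.space a} (hx : Generates x) {f g : M ⟶ N}
    (h : Hom.app f a x = Hom.app g a x) : f = g := by
  have heq : ∀ b, (eqSubrep f g).carrier b = ⊤ := by
    simpa only [Subrep.IsProper, ne_eq, not_exists, not_not] using hx (eqSubrep f g) h
  refine QuiverRep.hom_ext fun b y => ?_
  have hy : y ∈ (eqSubrep f g).carrier b := heq b ▸ Submodule.mem_top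
  exact hy

theorem Generates.app_ne_zero {a : Q} {x : M.space a} (hx : Generates x) {f : M ⟶ N}
    (hf : f ≠ 0) : Hom.app f a x ≠ 0 :=
  fun h => hf (hx.hom_ext h)

theorem Generates.isIndecomposable {a : Q} {x : M.space a} (hx : Generates x)
    (ha : Module.finrank K (M.space a) = 1) : M.IsIndecomposable := by
  have : IsSimpleModule K (M.space a) := isSimpleModule_iff_finrank_eq_one.2 ha
  refine ⟨⟨a, IsSimpleModule.nontrivial K _⟩, ?_⟩
  rintro ⟨S, T, hS, hT, hST⟩
  rcases eq_bot_or_eq_top (S.carrier a) with hbot | htop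
  · have htop : T.carrier a = ⊤ := eq_top_of_bot_isCompl (hbot ▸ hST a)
    exact hx T (htop ▸ Submodule.mem_top) hT
  · exact hx S (htop ▸ Submodule.mem_top) hS

end Indecomposable

section Irreducible

theorem IsIrreducible.ne_zero {f : M ⟶ N} (hf : IsIrreducible f) : f ≠ 0 := by
  rintro rfl
  rcases hf.2 N 0 0 Limits.zero_comp.symm with h | h
  · have hid : 𝟙 N = 0 := (IsSplitEpi.id (0 : N ⟶ N)).symm.trans Limits.comp_zero
    exact hf.1.2 ⟨⟨⟨0, Limits.zero_comp.trans hid.symm⟩⟩⟩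
  · exact hf.1.1 h

theorem IsIrreducible.iso_comp_iso {M' N' : QuiverRep K Q} {f : M ⟶ N} (hf : IsIrreducible f)
    (s : M' ≅ M) (t : N ≅ N') : IsIrreducible (s.hom ≫ f ≫ t.hom) := by
  have hconj : s.inv ≫ (s.hom ≫ f ≫ t.hom) ≫ t.inv = f := by
    simp only [Category.assoc, Iso.inv_hom_id_assoc, Iso.hom_inv_id, Category.comp_id]
  refine ⟨⟨fun _ => hf.1.1 ?_, fun _ => hf.1.2 ?_⟩, fun W f₂ f₁ h => ?_⟩
  · rw [← hconj]
    infer_instance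
  · rw [← hconj]
    infer_instance
  · have hfactor : f = (s.inv ≫ f₂) ≫ f₁ ≫ t.inv := by
      rw [← hconj, h]
      simp only [Category.assoc]
    rcases hf.2 W _ _ hfactor with hf₁ | hf₂
    · refine Or.inl ?_
      rw [← Category.comp_id f₁, ← t.inv_hom_id, ← Category.assoc]
      infer_instance
    · refine Or.inr ?_
      rw [← s.hom_inv_id_assoc f₂]
      infer_instance

theorem isoClass_eq_iff : M.isoClass = N.isoClass ↔ Nonempty (M ≅ N) :=
  Quotient.eq (r := isIsomorphicSetoid (QuiverRep K Q))

theorem nonempty_arQuiver_hom_iff {x y : ARQuiver K Q} (hx : M.isoClass = x.1)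
    (hy : N.isoClass = y.1) : Nonempty (x ⟶ y) ↔ ∃ f : M ⟶ N, IsIrreducible f := by
  constructor
  · rintro ⟨⟨M', N', f, hM', hN', hf⟩⟩
    obtain ⟨s⟩ := isoClass_eq_iff.1 (hx.trans hM'.symm)
    obtain ⟨t⟩ := isoClass_eq_iff.1 (hN'.trans hy.symm)
    exact ⟨_, hf.iso_comp_iso s t⟩
  · rintro ⟨f, hf⟩
    exact ⟨⟨M, N, f, hx, hy, hf⟩⟩

end Irreducible

end QuiverRep

namespace LinearA

open Quiver

variable {n : ℕ} {i j : LinearA n}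

theorem ext (h : i.1 = j.1) : i = j := Subtype.ext h

theorem succ_eq_of_hom (α : i ⟶ j) : i.1 + 1 = j.1 := α.down

theorem exists_succ_eq (h : i.1 < j.1) : ∃ k : LinearA n, k.1 + 1 = j.1 :=
  ⟨⟨j.1 - 1, Nat.le_sub_one_of_lt (i.2.1.trans_lt h), (Nat.sub_le _ _).trans j.2.2⟩,
    Nat.sub_add_cancel j.2.1⟩

theorem le_of_path (p : Path i j) : i.1 ≤ j.1 := by
  induction p with
  | nil => exact le_rfl
  | cons _ α ih => exact ih.trans (succ_eq_of_hom α ▸ Nat.le_succ _)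

theorem nonempty_path (h : i.1 ≤ j.1) : Nonempty (Path i j) := by
  obtain ⟨j, hj⟩ := j
  change i.1 ≤ j at h
  induction j, h using Nat.le_induction with
  | base => exact ⟨.nil⟩
  | succ j hij ih =>
    obtain ⟨p⟩ := ih ⟨i.2.1.trans hij, (Nat.le_succ j).trans hj.2⟩
    exact ⟨p.cons ⟨rfl⟩⟩

instance : Subsingleton (i ⟶ j) := inferInstanceAs (Subsingleton (PLift _))

instance : Subsingleton (Path i j) where
  allEq p q := by
    induction p with
    | nil =>
      cases q with
      | nil => rfl
      | cons q β =>
        have hq := le_of_path q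
        have hβ := succ_eq_of_hom β
        omega
    | cons p α ih =>
      have hp := le_of_path p
      have hα := succ_eq_of_hom α
      cases q with
      | nil => omega
      | cons q β =>
        obtain rfl := ext (Nat.succ_injective (hα.trans (succ_eq_of_hom β).symm))
        rw [ih q, Subsingleton.elim α β]

end LinearA

namespace QuiverRep

open Quiver

variable {K : Type u} [Field K] {n : ℕ} {M N : QuiverRep K (LinearA n)} {b d i j k : LinearA n}

/-- The composite of the maps of `M` along the path from `i` to `j`; by convention it is zero if
there is no such path, that is, if `j < i`. -/
noncomputable def transition (M : QuiverRep K (LinearA n)) (i j : LinearA n) :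
    M.space i →ₗ[K] M.space j :=
  if h : i.1 ≤ j.1 then M.mapPath (LinearA.nonempty_path h).some else 0

theorem mapPath_eq_transition (p : Path i j) : M.mapPath p = M.transition i j := by
  rw [transition, dif_pos (LinearA.le_of_path p)]
  exact congrArg M.mapPath (Subsingleton.elim _ _)

theorem transition_of_lt (h : j.1 < i.1) : M.transition i j = 0 :=
  dif_neg (not_le.2 h)

@[simp]
theorem transition_self (i : LinearA n) : M.transition i i = LinearMap.id :=
  (mapPath_eq_transition .nil).symm

theorem transition_comp (hij : i.1 ≤ j.1) (hjk : j.1 ≤ k.1) :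
    M.transition j k ∘ₗ M.transition i j = M.transition i k := by
  obtain ⟨p⟩ := LinearA.nonempty_path hij
  obtain ⟨q⟩ := LinearA.nonempty_path hjk
  rw [← mapPath_eq_transition p, ← mapPath_eq_transition q, ← mapPath_comp, mapPath_eq_transition]

theorem transition_transition (hij : i.1 ≤ j.1) (hjk : j.1 ≤ k.1) (x : M.space i) :
    M.transition j k (M.transition i j x) = M.transition i k x :=
  LinearMap.congr_fun (transition_comp hij hjk) x

theorem map_eq_transition (α : i ⟶ j) : M.map α = M.transition i j :=
  mapPath_eq_transition α.toPath

theorem app_transition (f : M ⟶ N) (i j : LinearA n) (x : M.space i) :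
    Hom.app f j (M.transition i j x) = N.transition i j (Hom.app f i x) := by
  unfold transition
  split_ifs
  · exact app_mapPath f _ x
  · exact map_zero _

theorem Subrep.transition_mem (S : M.Subrep) (j : LinearA n) {x : M.space i}
    (hx : x ∈ S.carrier i) : M.transition i j x ∈ S.carrier j := by
  unfold transition
  split_ifs
  · exact S.mapPath_mem _ hx
  · exact zero_mem _

section BirthAndDeath

/-- The vectors of `M` at `d` that are born before `b`, i.e. are sums of vectors coming from the
vertices `i < b`. -/
noncomputable def bornBefore (M : QuiverRep K (LinearA n)) (b d : LinearA n) :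
    Submodule K (M.space d) :=
  ⨆ (i : LinearA n) (_ : i.1 < b.1), LinearMap.range (M.transition i d)

/-- The vectors of `M` at `b` that are dead after `d`, i.e. vanish at the vertices `j > d`. -/
noncomputable def deadAfter (M : QuiverRep K (LinearA n)) (b d : LinearA n) :
    Submodule K (M.space b) :=
  ⨅ (j : LinearA n) (_ : d.1 < j.1), LinearMap.ker (M.transition b j)

theorem range_transition_le_bornBefore (hi : i.1 < b.1) (d : LinearA n) :
    LinearMap.range (M.transition i d) ≤ M.bornBefore b d :=
  le_iSup₂_of_le i hi le_rfl

theorem mem_deadAfter {x : M.space b} :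
    x ∈ M.deadAfter b d ↔ ∀ j : LinearA n, d.1 < j.1 → M.transition b j x = 0 := by
  simp only [deadAfter, Submodule.mem_iInf, LinearMap.mem_ker]

theorem bornBefore_eq_bot (h : ∀ i : LinearA n, i.1 < b.1 → Subsingleton (M.space i))
    (d : LinearA n) : M.bornBefore b d = ⊥ := by
  refine eq_bot_iff.2 (iSup₂_le fun i hi => ?_)
  rintro _ ⟨x, rfl⟩
  have := h i hi
  rw [Subsingleton.elim x 0, map_zero]
  exact zero_mem _

theorem bornBefore_eq_range (hi : i.1 + 1 = b.1) (hid : i.1 ≤ d.1) :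
    M.bornBefore b d = LinearMap.range (M.transition i d) := by
  refine le_antisymm (iSup₂_le fun j hj => ?_) (range_transition_le_bornBefore (by omega) d)
  rw [← transition_comp (by omega : j.1 ≤ i.1) hid]
  exact LinearMap.range_comp_le_range _ _

theorem deadAfter_eq_ker (hj : d.1 + 1 = j.1) (hbj : b.1 ≤ j.1) :
    M.deadAfter b d = LinearMap.ker (M.transition b j) := by
  refine le_antisymm (iInf₂_le j (by omega)) (le_iInf₂ fun k hk => ?_)
  rw [← transition_comp hbj (by omega : j.1 ≤ k.1)]
  exact LinearMap.ker_le_ker_comp _ _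

theorem map_transition_bornBefore (hbd : b.1 ≤ d.1) :
    (M.bornBefore b b).map (M.transition b d) = M.bornBefore b d := by
  simp only [bornBefore, Submodule.map_iSup, ← LinearMap.range_comp]
  exact iSup_congr fun i => iSup_congr fun hi => by rw [transition_comp hi.le hbd]

theorem comap_transition_deadAfter (hbd : b.1 ≤ d.1) :
    (M.deadAfter d d).comap (M.transition b d) = M.deadAfter b d := by
  simp only [deadAfter, Submodule.comap_iInf, ← LinearMap.ker_comp]
  exact iInf_congr fun j => iInf_congr fun hj => by rw [transition_comp hbd hj.le]

theorem app_mem_bornBefore (f : M ⟶ N) {x : M.space d} (hx : x ∈ M.bornBefore b d) :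
    Hom.app f d x ∈ N.bornBefore b d := by
  suffices h : M.bornBefore b d ≤ (N.bornBefore b d).comap (Hom.app f d) from h hx
  refine iSup₂_le fun i hi => ?_
  rintro _ ⟨z, rfl⟩
  rw [Submodule.mem_comap, app_transition]
  exact range_transition_le_bornBefore hi d ⟨_, rfl⟩

theorem app_mem_deadAfter (f : M ⟶ N) {x : M.space b} (hx : x ∈ M.deadAfter b d) :
    Hom.app f b x ∈ N.deadAfter b d :=
  mem_deadAfter.2 fun j hj => by rw [← app_transition, mem_deadAfter.1 hx j hj, map_zero]

end BirthAndDeath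

end QuiverRep

theorem mem_intervalSpace {K : Type u} [Field K] {b d i : ℕ} {c : K} :
    c ∈ intervalSpace K b d i ↔ (b ≤ i ∧ i ≤ d) ∨ c = 0 := by
  unfold intervalSpace
  split_ifs with h
  · exact iff_of_true Submodule.mem_top (Or.inl h)
  · rw [Submodule.mem_bot, or_iff_right h]

namespace intervalRep

open QuiverRep

variable {K : Type u} [Field K] {n : ℕ}

section Vectors

variable {b d : ℕ} {i j : LinearA n}

/-- The element of `K` underlying a vector of an interval representation. -/
noncomputable def coeff : (intervalRep K n b d).space i →ₗ[K] K :=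
  (intervalSpace K b d i.1).subtype

theorem coeff_injective :
    Function.Injective (coeff : (intervalRep K n b d).space i →ₗ[K] K) :=
  Subtype.val_injective

theorem subsingleton_space (h : ¬ (b ≤ i.1 ∧ i.1 ≤ d)) :
    Subsingleton ((intervalRep K n b d).space i) where
  allEq x y := Subtype.ext <|
    ((mem_intervalSpace.1 x.2).resolve_left h).trans ((mem_intervalSpace.1 y.2).resolve_left h).symm

theorem eq_zero_of_notMem_support (h : ¬ (b ≤ i.1 ∧ i.1 ≤ d))
    (x : (intervalRep K n b d).space i) : x = 0 :=
  (subsingleton_space h).elim _ _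

theorem coeff_map (α : i ⟶ j) (hi : b ≤ i.1) (hj : j.1 ≤ d)
    (x : (intervalRep K n b d).space i) :
    coeff ((intervalRep K n b d).map α x) = coeff x := by
  have hα := LinearA.succ_eq_of_hom α
  change ((intervalMap K b d i.1 j.1 x : intervalSpace K b d j.1) : K) = _
  rw [intervalMap, dif_pos ⟨⟨hi, by omega⟩, by omega, hj⟩]
  rfl

theorem coeff_transition (hij : i.1 ≤ j.1) (hi : b ≤ i.1) (hj : j.1 ≤ d)
    (x : (intervalRep K n b d).space i) :
    coeff ((intervalRep K n b d).transition i j x) = coeff x := by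
  obtain ⟨p⟩ := LinearA.nonempty_path hij
  rw [← mapPath_eq_transition p]
  clear hij
  induction p with
  | nil => rfl
  | cons p α ih =>
    have hp := LinearA.le_of_path p
    have hα := LinearA.succ_eq_of_hom α
    rw [mapPath, LinearMap.comp_apply, coeff_map α (by omega) hj, ih (by omega)]

end Vectors

variable {M : QuiverRep K (LinearA n)} {b d b' d' c e i j : LinearA n}

local notation "𝕀[" b "," d "]" => intervalRep K n (Subtype.val b) (Subtype.val d)

theorem bornBefore_eq_bot (h : b.1 ≤ b'.1) (i : LinearA n) : 𝕀[b',d'].bornBefore b i = ⊥ :=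
  QuiverRep.bornBefore_eq_bot (fun _ _ => subsingleton_space (by omega)) i

theorem mem_deadAfter_of_le (h : d'.1 ≤ d.1) (x : 𝕀[b',d'].space i) : x ∈ 𝕀[b',d'].deadAfter i d :=
  mem_deadAfter.2 fun _ _ => eq_zero_of_notMem_support (by omega) _

/-- The vector `1` of `I[b,d]` at `b`, which generates `I[b,d]`. -/
noncomputable def gen (hbd : b.1 ≤ d.1) : 𝕀[b,d].space b :=
  (⟨1, mem_intervalSpace.2 (Or.inl ⟨le_rfl, hbd⟩)⟩ : intervalSpace K b.1 d.1 b.1)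

theorem coeff_gen (hbd : b.1 ≤ d.1) : coeff (gen hbd : 𝕀[b,d].space b) = 1 := rfl

theorem gen_ne_zero (hbd : b.1 ≤ d.1) : (gen hbd : 𝕀[b,d].space b) ≠ 0 :=
  fun h => one_ne_zero (congrArg coeff h)

theorem eq_coeff_smul_gen (hbd : b.1 ≤ d.1) (x : 𝕀[b,d].space i) :
    x = coeff x • 𝕀[b,d].transition b i (gen hbd) := by
  by_cases h : b.1 ≤ i.1 ∧ i.1 ≤ d.1
  · refine coeff_injective ?_
    rw [map_smul, coeff_transition h.1 le_rfl h.2, coeff_gen, smul_eq_mul, mul_one]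
  · exact (subsingleton_space h).elim _ _

theorem transition_bijective (hi : b.1 ≤ i.1) (hij : i.1 ≤ j.1) (hj : j.1 ≤ d.1) :
    Function.Bijective (𝕀[b,d].transition i j) := by
  have hbd : b.1 ≤ d.1 := by omega
  refine ⟨fun x y hxy => coeff_injective ?_, fun y => ?_⟩
  · rw [← coeff_transition hij hi hj x, hxy, coeff_transition hij hi hj]
  · refine ⟨coeff y • 𝕀[b,d].transition b i (gen hbd), ?_⟩
    rw [map_smul, transition_transition hi hij, ← eq_coeff_smul_gen]

theorem generates_gen (hbd : b.1 ≤ d.1) : Generates (gen hbd : 𝕀[b,d].space b) := by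
  rintro S hS ⟨a, ha⟩
  refine ha (eq_top_iff.2 fun x _ => ?_)
  rw [eq_coeff_smul_gen hbd x]
  exact Submodule.smul_mem _ _ (S.transition_mem a hS)

theorem finrank_space_birth (hbd : b.1 ≤ d.1) : Module.finrank K (𝕀[b,d].space b) = 1 :=
  finrank_eq_one (gen hbd) (gen_ne_zero hbd) fun x =>
    ⟨coeff x, by
      simpa only [transition_self, LinearMap.id_apply] using (eq_coeff_smul_gen hbd x).symm⟩

theorem isIndecomposable (hbd : b.1 ≤ d.1) : 𝕀[b,d].IsIndecomposable :=
  (generates_gen hbd).isIndecomposable (finrank_space_birth hbd)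

theorem nontrivial_space_iff : Nontrivial (𝕀[b,d].space i) ↔ b.1 ≤ i.1 ∧ i.1 ≤ d.1 := by
  refine ⟨fun h => ?_, fun h => ?_⟩
  · by_contra hi
    exact not_subsingleton _ (subsingleton_space (K := K) hi)
  · have hbd : b.1 ≤ d.1 := h.1.trans h.2
    refine ⟨𝕀[b,d].transition b i (gen hbd), 0, fun h₀ => gen_ne_zero (K := K) hbd ?_⟩
    exact (transition_bijective le_rfl h.1 h.2).1 (h₀.trans (map_zero _).symm)

theorem eq_of_iso (hbd : b.1 ≤ d.1) (hbd' : b'.1 ≤ d'.1) (s : 𝕀[b,d] ≅ 𝕀[b',d']) :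
    b = b' ∧ d = d' := by
  have hsupp : ∀ i : LinearA n, (b.1 ≤ i.1 ∧ i.1 ≤ d.1) ↔ (b'.1 ≤ i.1 ∧ i.1 ≤ d'.1) := by
    intro i
    rw [← nontrivial_space_iff (K := K), ← nontrivial_space_iff (K := K)]
    exact ⟨fun _ => (app_injective s.hom i).nontrivial, fun _ => (app_injective s.inv i).nontrivial⟩
  have hb := hsupp b
  have hd := hsupp d
  have hb' := hsupp b'
  have hd' := hsupp d'
  exact ⟨LinearA.ext (by omega), LinearA.ext (by omega)⟩

theorem eq_of_isSplitMono (hbd : b.1 ≤ d.1) (hbd' : b'.1 ≤ d'.1) (f : 𝕀[b,d] ⟶ 𝕀[b',d'])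
    [IsSplitMono f] : b = b' ∧ d = d' :=
  have := (isIndecomposable hbd').isIso_of_isSplitMono (isIndecomposable hbd).1 f
  eq_of_iso hbd hbd' (asIso f)

theorem eq_of_isSplitEpi (hbd : b.1 ≤ d.1) (hbd' : b'.1 ≤ d'.1) (f : 𝕀[b,d] ⟶ 𝕀[b',d'])
    [IsSplitEpi f] : b = b' ∧ d = d' :=
  have := (isIndecomposable hbd).isIso_of_isSplitEpi (isIndecomposable hbd').1 f
  eq_of_iso hbd hbd' (asIso f)

section UniversalProperties

/-- The morphism from `I[b,d]` that sends the generator to a vector `x` at `b` that is dead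
after `d`. -/
noncomputable def homOfVec (x : M.space b) (hx : x ∈ M.deadAfter b d) : 𝕀[b,d] ⟶ M where
  app i := coeff.smulRight (M.transition b i x)
  comm {i j} α := by
    ext y
    have hα := LinearA.succ_eq_of_hom α
    change M.map α (coeff y • M.transition b i x) = coeff (𝕀[b,d].map α y) • M.transition b j x
    by_cases hi : b.1 ≤ i.1 ∧ i.1 ≤ d.1
    · rw [map_smul, map_eq_transition, transition_transition hi.1 (by omega)]
      by_cases hj : j.1 ≤ d.1
      · rw [coeff_map α hi.1 hj]
      · rw [mem_deadAfter.1 hx j (by omega), smul_zero, smul_zero]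
    · simp only [eq_zero_of_notMem_support hi y, map_zero, zero_smul]

theorem homOfVec_app_gen (hbd : b.1 ≤ d.1) (x : M.space b) (hx : x ∈ M.deadAfter b d) :
    Hom.app (homOfVec x hx) b (gen hbd) = x := by
  change (1 : K) • M.transition b b x = x
  rw [transition_self, LinearMap.id_apply, one_smul]

/-- The morphism to `I[b,d]` given by a functional at `d` that kills the vectors born
before `b`. -/
noncomputable def homOfFunctional (φ : M.space d →ₗ[K] K)
    (hφ : M.bornBefore b d ≤ LinearMap.ker φ) : M ⟶ 𝕀[b,d] where
  app i := LinearMap.codRestrict (intervalSpace K b.1 d.1 i.1) (φ ∘ₗ M.transition i d) fun z => by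
    rw [mem_intervalSpace, or_iff_not_imp_left]
    intro hi
    rcases lt_or_ge i.1 b.1 with hb | hb
    · exact hφ (range_transition_le_bornBefore hb d ⟨z, rfl⟩)
    · rw [transition_of_lt (by omega), LinearMap.comp_zero, LinearMap.zero_apply]
  comm {i j} α := by
    ext z
    have hα := LinearA.succ_eq_of_hom α
    by_cases hj : b.1 ≤ j.1 ∧ j.1 ≤ d.1
    · have hφα : φ (M.transition j d (M.map α z)) = φ (M.transition i d z) := by
        rw [map_eq_transition, transition_transition (by omega) hj.2]
      refine coeff_injective (Eq.trans ?_ hφα.symm)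
      by_cases hi : b.1 ≤ i.1
      · exact coeff_map α hi hj.2 _
      · have hzero : ∀ y : 𝕀[b,d].space i, coeff (𝕀[b,d].map α y) = 0 := fun y => by
          rw [eq_zero_of_notMem_support (fun h => hi h.1) y, map_zero, map_zero]
        exact (hzero _).trans (hφ (range_transition_le_bornBefore (not_le.1 hi) d ⟨z, rfl⟩)).symm
    · exact (subsingleton_space hj).elim _ _

theorem coeff_homOfFunctional_app (φ : M.space d →ₗ[K] K)
    (hφ : M.bornBefore b d ≤ LinearMap.ker φ) (z : M.space i) :
    coeff (Hom.app (homOfFunctional φ hφ) i z) = φ (M.transition i d z) := rfl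

theorem isSplitMono_of_notMem_bornBefore (hbd : b.1 ≤ d.1) (f : 𝕀[b,d] ⟶ M)
    (h : M.transition b d (Hom.app f b (gen hbd)) ∉ M.bornBefore b d) : IsSplitMono f := by
  obtain ⟨φ, hφ, hker⟩ := Submodule.exists_le_ker_of_notMem h
  set a := φ (M.transition b d (Hom.app f b (gen hbd)))
  refine ⟨⟨⟨homOfFunctional (a⁻¹ • φ) (hker.trans fun z hz => ?_),
    (generates_gen hbd).hom_ext (coeff_injective ?_)⟩⟩⟩
  · rw [LinearMap.mem_ker, LinearMap.smul_apply, LinearMap.mem_ker.1 hz, smul_zero]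
  · rw [comp_app, LinearMap.comp_apply, coeff_homOfFunctional_app, LinearMap.smul_apply]
    exact (inv_mul_cancel₀ hφ).trans (coeff_gen hbd).symm

theorem isSplitEpi_of_app_ne_zero (hbd : b.1 ≤ d.1) (f : M ⟶ 𝕀[b,d]) {y : M.space b}
    (hy : y ∈ M.deadAfter b d) (h : Hom.app f b y ≠ 0) : IsSplitEpi f := by
  set a := coeff (Hom.app f b y) with ha_def
  have ha : a ≠ 0 := fun h₀ => h (coeff_injective (h₀.trans (map_zero coeff).symm))
  refine ⟨⟨⟨homOfVec (a⁻¹ • y) (Submodule.smul_mem _ _ hy), (generates_gen hbd).hom_ext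
    (coeff_injective ?_)⟩⟩⟩
  rw [comp_app, LinearMap.comp_apply, homOfVec_app_gen, map_smul, map_smul, ← ha_def]
  exact (inv_mul_cancel₀ ha).trans (coeff_gen hbd).symm

end UniversalProperties

theorem exists_isSplitMono (hM : ∃ a, Nontrivial (M.space a)) :
    ∃ b d : LinearA n, b.1 ≤ d.1 ∧ ∃ f : 𝕀[b,d] ⟶ M, IsSplitMono f := by
  obtain ⟨b, hb, hmin⟩ := (measure fun a : LinearA n => a.1).wf.has_min
    {a | Nontrivial (M.space a)} hM
  obtain ⟨x, hx⟩ := @exists_ne _ hb (0 : M.space b)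
  obtain ⟨d, hd, hmax⟩ := (measure fun a : LinearA n => n - a.1).wf.has_min
    {a | M.transition b a x ≠ 0} ⟨b, by rwa [Set.mem_ofPred_eq, transition_self]⟩
  have hbd : b.1 ≤ d.1 := by
    by_contra h
    exact hd (by rw [transition_of_lt (not_le.1 h), LinearMap.zero_apply])
  have hdead : x ∈ M.deadAfter b d := by
    refine mem_deadAfter.2 fun j hj => not_not.1 fun hne => hmax j hne ?_
    exact Nat.sub_lt_sub_left (hj.trans_le j.2.2) hj
  have hborn : M.bornBefore b d = ⊥ :=
    QuiverRep.bornBefore_eq_bot (fun i hi => not_nontrivial_iff_subsingleton.1 (hmin i · hi)) d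
  refine ⟨b, d, hbd, homOfVec x hdead, isSplitMono_of_notMem_bornBefore hbd _ ?_⟩
  rwa [homOfVec_app_gen, hborn, Submodule.mem_bot]

theorem exists_iso_of_isIndecomposable (hM : M.IsIndecomposable) :
    ∃ b d : LinearA n, b.1 ≤ d.1 ∧ Nonempty (𝕀[b,d] ≅ M) := by
  obtain ⟨b, d, hbd, f, _⟩ := exists_isSplitMono hM.1
  have := hM.isIso_of_isSplitMono (isIndecomposable hbd).1 f
  exact ⟨b, d, hbd, ⟨asIso f⟩⟩

theorem exists_hom_ne_zero_iff (hbd : b.1 ≤ d.1) :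
    (∃ f : 𝕀[b,d] ⟶ 𝕀[b',d'], f ≠ 0) ↔ b'.1 ≤ b.1 ∧ b.1 ≤ d'.1 ∧ d'.1 ≤ d.1 := by
  constructor
  · rintro ⟨f, hf⟩
    have hgen := (generates_gen hbd).app_ne_zero hf
    have hb : b'.1 ≤ b.1 ∧ b.1 ≤ d'.1 :=
      not_not.1 fun h => hgen (eq_zero_of_notMem_support h _)
    refine ⟨hb.1, hb.2, not_lt.1 fun hd => hgen ?_⟩
    apply (transition_bijective hb.1 hb.2 le_rfl).1
    rw [← app_transition, eq_zero_of_notMem_support (fun h => absurd h.2 (not_le.2 hd))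
      (𝕀[b,d].transition b d' _), map_zero, map_zero]
  · rintro ⟨hb, hbd', hd⟩
    have hbd'' : b'.1 ≤ d'.1 := hb.trans hbd'
    let x : 𝕀[b',d'].space b := 𝕀[b',d'].transition b' b (gen hbd'')
    refine ⟨homOfVec x (mem_deadAfter_of_le hd x), fun h₀ => gen_ne_zero (K := K) hbd'' ?_⟩
    apply (transition_bijective le_rfl hb hbd').1
    rw [map_zero, ← zero_app_apply (M := 𝕀[b,d]) b (gen hbd), ← h₀, homOfVec_app_gen]

theorem exists_factorization (f : 𝕀[b,d] ⟶ 𝕀[b',d']) (hc' : b'.1 ≤ c.1) (hc : c.1 ≤ b.1)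
    (hb : b.1 ≤ d'.1) (he' : d'.1 ≤ e.1) (he : e.1 ≤ d.1) :
    ∃ (f₂ : 𝕀[b,d] ⟶ 𝕀[c,e]) (f₁ : 𝕀[c,e] ⟶ 𝕀[b',d']), f = f₂ ≫ f₁ := by
  have hbd : b.1 ≤ d.1 := by omega
  have hce : c.1 ≤ e.1 := by omega
  obtain ⟨y, hy⟩ := (transition_bijective hc' hc hb).2 (Hom.app f b (gen hbd))
  refine ⟨homOfVec (𝕀[c,e].transition c b (gen hce)) (mem_deadAfter_of_le he _),
    homOfVec y (mem_deadAfter_of_le he' y), (generates_gen hbd).hom_ext ?_⟩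
  rw [comp_app, LinearMap.comp_apply, homOfVec_app_gen, app_transition, homOfVec_app_gen, hy]

theorem isIrreducible_of_succ_birth (hbd : b.1 ≤ d.1) (hb : b'.1 + 1 = b.1)
    {f : 𝕀[b,d] ⟶ 𝕀[b',d]} (hf : f ≠ 0) : IsIrreducible f := by
  have hbd' : b'.1 ≤ d.1 := by omega
  have hne : b ≠ b' := by
    rintro rfl
    omega
  refine ⟨⟨fun _ => hne (eq_of_isSplitMono hbd hbd' f).1,
    fun _ => hne (eq_of_isSplitEpi hbd hbd' f).1⟩, fun W f₂ f₁ h => or_iff_not_imp_right.2 ?_⟩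
  intro hf₂
  have hborn : W.transition b d (Hom.app f₂ b (gen hbd)) ∈ W.bornBefore b d :=
    not_not.1 (mt (isSplitMono_of_notMem_bornBefore hbd f₂) hf₂)
  rw [bornBefore_eq_range hb hbd'] at hborn
  obtain ⟨z, hz⟩ := hborn
  have hdead : z ∈ W.deadAfter b' d := by
    rw [← comap_transition_deadAfter hbd', Submodule.mem_comap, hz, ← Submodule.mem_comap,
      comap_transition_deadAfter hbd]
    exact app_mem_deadAfter f₂ (mem_deadAfter_of_le le_rfl _)
  refine isSplitEpi_of_app_ne_zero hbd' f₁ hdead fun h₀ => ?_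
  refine (generates_gen hbd).app_ne_zero hf ((transition_bijective (by omega) hbd le_rfl).1 ?_)
  rw [h, comp_app, LinearMap.comp_apply, ← app_transition, ← hz, app_transition, h₀, map_zero,
    map_zero]

theorem isIrreducible_of_succ_death (hbd' : b.1 ≤ d'.1) (hd : d'.1 + 1 = d.1)
    {f : 𝕀[b,d] ⟶ 𝕀[b,d']} (hf : f ≠ 0) : IsIrreducible f := by
  have hbd : b.1 ≤ d.1 := by omega
  have hne : d ≠ d' := by
    rintro rfl
    omega
  refine ⟨⟨fun _ => hne (eq_of_isSplitMono hbd hbd' f).2,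
    fun _ => hne (eq_of_isSplitEpi hbd hbd' f).2⟩, fun W f₂ f₁ h => or_iff_not_imp_right.2 ?_⟩
  intro hf₂
  have hborn : W.transition b d (Hom.app f₂ b (gen hbd)) ∈ W.bornBefore b d :=
    not_not.1 (mt (isSplitMono_of_notMem_bornBefore hbd f₂) hf₂)
  rw [← map_transition_bornBefore hbd] at hborn
  obtain ⟨z, hz, hzd⟩ := hborn
  have hdead : Hom.app f₂ b (gen hbd) - z ∈ W.deadAfter b d' := by
    rw [deadAfter_eq_ker hd hbd, LinearMap.mem_ker, map_sub, hzd, sub_self]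
  have hf₁z : Hom.app f₁ b z = 0 := by
    rw [← Submodule.mem_bot K, ← bornBefore_eq_bot (K := K) (d' := d') le_rfl b]
    exact app_mem_bornBefore f₁ hz
  refine isSplitEpi_of_app_ne_zero hbd' f₁ hdead ?_
  rw [map_sub, hf₁z, sub_zero, ← LinearMap.comp_apply, ← comp_app, ← h]
  exact (generates_gen hbd).app_ne_zero hf

theorem isSplitMono_of_ne_zero (hbd : b.1 ≤ d.1) {f : 𝕀[b,d] ⟶ 𝕀[b,d]} (hf : f ≠ 0) :
    IsSplitMono f := by
  refine isSplitMono_of_notMem_bornBefore hbd f ?_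
  rw [bornBefore_eq_bot le_rfl, Submodule.mem_bot]
  exact (map_ne_zero_iff _ (transition_bijective le_rfl hbd le_rfl).1).2
    ((generates_gen hbd).app_ne_zero hf)

theorem succ_eq_of_isIrreducible (hbd : b.1 ≤ d.1) (hbd' : b'.1 ≤ d'.1)
    {f : 𝕀[b,d] ⟶ 𝕀[b',d']} (hf : IsIrreducible f) :
    (b'.1 + 1 = b.1 ∧ d' = d) ∨ (b' = b ∧ d'.1 + 1 = d.1) := by
  obtain ⟨hb, hbd'', hd⟩ := (exists_hom_ne_zero_iff hbd).1 ⟨f, hf.ne_zero⟩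
  have between : ∀ c e : LinearA n, b'.1 ≤ c.1 → c.1 ≤ b.1 → d'.1 ≤ e.1 → e.1 ≤ d.1 →
      (c = b' ∧ e = d') ∨ (b = c ∧ d = e) := by
    intro c e hc' hc he' he
    obtain ⟨f₂, f₁, h⟩ := exists_factorization f hc' hc hbd'' he' he
    rcases hf.2 _ f₂ f₁ h with hf₁ | hf₂
    · exact Or.inl (eq_of_isSplitEpi (by omega) hbd' f₁)
    · exact Or.inr (eq_of_isSplitMono hbd (by omega) f₂)
  rcases hb.lt_or_eq with hlt | heq
  · obtain ⟨c, hc⟩ := LinearA.exists_succ_eq hlt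
    rcases between c d (by omega) (by omega) hd le_rfl with ⟨rfl, rfl⟩ | ⟨rfl, -⟩
    · exact Or.inl ⟨hc, rfl⟩
    · omega
  · obtain rfl := LinearA.ext heq
    have hne : d'.1 ≠ d.1 := fun h => by
      obtain rfl := LinearA.ext h
      exact hf.1.1 (isSplitMono_of_ne_zero hbd hf.ne_zero)
    obtain ⟨e, he⟩ := LinearA.exists_succ_eq (hd.lt_of_ne hne)
    rcases between b' e le_rfl le_rfl (by omega) (by omega) with ⟨-, rfl⟩ | ⟨-, rfl⟩
    · exact Or.inr ⟨rfl, he⟩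
    · omega

theorem exists_isIrreducible_iff (hbd : b.1 ≤ d.1) (hbd' : b'.1 ≤ d'.1) :
    (∃ f : 𝕀[b,d] ⟶ 𝕀[b',d'], IsIrreducible f) ↔
      (b'.1 + 1 = b.1 ∧ d' = d) ∨ (b' = b ∧ d'.1 + 1 = d.1) := by
  constructor
  · rintro ⟨f, hf⟩
    exact succ_eq_of_isIrreducible hbd hbd' hf
  · rintro (⟨hb, rfl⟩ | ⟨rfl, hd⟩)
    · have hmor : ∃ f : 𝕀[b,d'] ⟶ 𝕀[b',d'], f ≠ 0 :=
        (exists_hom_ne_zero_iff hbd).2 ⟨by omega, hbd, le_rfl⟩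
      obtain ⟨f, hf⟩ := hmor
      exact ⟨f, isIrreducible_of_succ_birth hbd hb hf⟩
    · have hmor : ∃ f : 𝕀[b',d] ⟶ 𝕀[b',d'], f ≠ 0 :=
        (exists_hom_ne_zero_iff hbd).2 ⟨le_rfl, hbd', by omega⟩
      obtain ⟨f, hf⟩ := hmor
      exact ⟨f, isIrreducible_of_succ_death hbd' hd hf⟩

end intervalRep

namespace PDGrid

variable {n : ℕ}

/-- The birth of a grid point, as a vertex. -/
def birth (p : PDGrid n) : LinearA n := ⟨p.1.1, p.2.1, p.2.2.1.trans p.2.2.2⟩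

/-- The death of a grid point, as a vertex. -/
def death (p : PDGrid n) : LinearA n := ⟨p.1.2, p.2.1.trans p.2.2.1, p.2.2.2⟩

theorem birth_le_death (p : PDGrid n) : p.birth.1 ≤ p.death.1 := p.2.2.1

variable (K : Type u) [Field K]

/-- The vertex of the Auslander–Reiten quiver given by the interval representation of a grid
point. -/
noncomputable def toARQuiver (p : PDGrid n) : ARQuiver K (LinearA n) :=
  ⟨(intervalRep K n p.1.1 p.1.2).isoClass, _, rfl,
    intervalRep.isIndecomposable (b := p.birth) (d := p.death) p.birth_le_death⟩

theorem toARQuiver_bijective : Function.Bijective (toARQuiver (n := n) K) := by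
  constructor
  · intro p q hpq
    obtain ⟨s⟩ := QuiverRep.isoClass_eq_iff.1 (congrArg Subtype.val hpq)
    obtain ⟨hb, hd⟩ := intervalRep.eq_of_iso p.birth_le_death q.birth_le_death s
    exact Subtype.ext (Prod.ext (congrArg Subtype.val hb) (congrArg Subtype.val hd))
  · rintro ⟨_, M, rfl, hM⟩
    obtain ⟨b, d, hbd, hiso⟩ := intervalRep.exists_iso_of_isIndecomposable hM
    exact ⟨⟨(b.1, d.1), b.2.1, hbd, d.2.2⟩, Subtype.ext (QuiverRep.isoClass_eq_iff.2 hiso)⟩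

end PDGrid

theorem theorem3p3 (K : Type u) [Field K] (n : ℕ) :
    ∃ e : PDGrid n ≃ ARQuiver K (LinearA n),
      (∀ p : PDGrid n, (e p).1 = (intervalRep K n p.1.1 p.1.2).isoClass) ∧
      ∀ p q : PDGrid n, Nonempty (e p ⟶ e q) ↔
        (q.1.1 + 1 = p.1.1 ∧ q.1.2 = p.1.2) ∨ (q.1.1 = p.1.1 ∧ q.1.2 + 1 = p.1.2) := by
  refine ⟨Equiv.ofBijective _ (PDGrid.toARQuiver_bijective K), fun _ => rfl, fun p q => ?_⟩
  rw [QuiverRep.nonempty_arQuiver_hom_iff rfl rfl]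
  refine (intervalRep.exists_isIrreducible_iff p.birth_le_death q.birth_le_death).trans ?_
  exact or_congr (and_congr_right' Subtype.ext_iff) (and_congr_left' Subtype.ext_iff)
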